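/- All graphs are finite and simple. The clique-width $\mathrm{cw}(G)$ of a graph $G$ is the least number of labels with which a vertex-labelled copy of $G$ can be built by the operations: create a vertex with label $i$; disjoint union of two labelled graphs; for labels $i\ne j$, join every vertex labelled $i$ to every vertex labelled $j$; relabel every vertex labelled $i$ with label $j$. Let $G$ be a graph whose vertex set is partitioned into layers $P_0,\dots,P_l$, each inducing a path oriented from left to right, where $P_0$ is a single vertex. The ancestors of $u\in P_i$ are its neighbours in $P_0\cup\dots\cup P_{i-1}$, and the type of $u$ is the number of its ancestors. Suppose that for $1\le i\le l$ both ends of $P_i$ have positive type. List the ancestor sets of the vertices of positive type of $P_i$ from left to right, and write $O_S$ (resp. $E_S$) for three (resp. four) successive entries equal to $S$. (a) $G$ is an $(l,k)$-ttf-layered-wheel if (for some such layers) for every $0\le i<l$ the list of $P_{i+1}$ is the concatenation, over the vertices $u$ of $P_i$ from left to right, of $\mathrm{Box}_u$, where $\mathrm{Box}_u=O_{\{u\}}$ if $u$ has type $0$, and $\mathrm{Box}_u=O_{\{u\}}O_{\{v\}}O_{\{u\}}$ if $u$ has type $1$ with ancestor $v$ (no other types arise); and any two consecutive vertices of positive type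 in a layer $P_i$, $1\le i\le l$, are at distance at least $k-2$ along $P_i$. (b) $G$ is an $(l,k)$-ehf-layered-wheel if (for some such layers) for every $0\le i<l$, writing $P_i=p_1\dots p_n$, the list of $P_{i+1}$ is $B_{p_1}E_{\{p_1,p_2\}}B_{p_2}E_{\{p_2,p_3\}}\cdots E_{\{p_{n-1},p_n\}}B_{p_n}$, where - $B_u=O_{\{u\}}$ if $u$ has type $0$; - $B_u=O_{\{u\}}O_{\{u,v\}}O_{\{u\}}$ if $u$ has type $1$ with ancestor $v$; - $B_u=E_{\{u\}}E_{\{v,w\}}O_{\{u\}}O_{\{u,v\}}O_{\{u\}}O_{\{u,w\}}O_{\{u\}}E_{\{v,w\}}E_{\{u\}}$ if $u$ has type $2$ with ancestors $v\in P_a$, $w\in P_b$, where $b\le a$, and $v$ is to the left of $w$ if $a=b$ (no other types arise); and for any two consecutive vertices of positive type in a layer $P_i$, $1\le i\le l$, their distance along $P_i$ is at least $k-2$, and it is odd if they have a common ancestor and even otherwise. Theorem. Let $l\ge 2$ and $k\ge 4$ be integers. Every layered wheel $G_{l,k}$, that is, every $(l,k)$-ttf-layered-wheel and every $(l,k)$-ehf-layered-wheel,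 satisfies $\mathrm{cw}(G_{l,k})\ge\frac{l+1}{6}$. -/

import Mathlib

/-! ### Clique-width -/

/-- A `c`-expression whose vertices are named by elements of `V`: create a vertex with a label,
disjoint union, join all vertices labelled `i` to all vertices labelled `j`, relabel `i` to `j`. -/
inductive CWExpr (V : Type*) (c : ℕ) where
  | vertex (v : V) (i : Fin c) : CWExpr V c
  | union (s t : CWExpr V c) : CWExpr V c
  | join (i j : Fin c) (t : CWExpr V c) : CWExpr V c
  | relabel (i j : Fin c) (t : CWExpr V c) : CWExpr V c

namespace CWExpr

variable {V : Type*} {c : ℕ}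

/-- `t.HasLabel v m`: `v` is a vertex of the graph built by `t`, and its final label is `m`. -/
def HasLabel : CWExpr V c → V → Fin c → Prop
  | vertex a i, v, m => v = a ∧ m = i
  | union s t, v, m => s.HasLabel v m ∨ t.HasLabel v m
  | join _ _ t, v, m => t.HasLabel v m
  | relabel i j t, v, m => ∃ m', t.HasLabel v m' ∧ m = if m' = i then j else m'

/-- The vertex set of the graph built by an expression. -/
def verts (t : CWExpr V c) : Set V := {v | ∃ m, t.HasLabel v m}

/-- The adjacency relation of the graph built by an expression. -/
def Adj : CWExpr V c → V → V → Prop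
  | vertex _ _, _, _ => False
  | union s t, x, y => s.Adj x y ∨ t.Adj x y
  | join i j t, x, y =>
      t.Adj x y ∨ (t.HasLabel x i ∧ t.HasLabel y j) ∨ (t.HasLabel x j ∧ t.HasLabel y i)
  | relabel _ _ t, x, y => t.Adj x y

/-- Unions are disjoint, and joins are between distinct labels. -/
def Valid : CWExpr V c → Prop
  | vertex _ _ => True
  | union s t => s.Valid ∧ t.Valid ∧ Disjoint s.verts t.verts
  | join i j t => i ≠ j ∧ t.Valid
  | relabel _ _ t => t.Valid

/-- The expression `t` builds the graph `G`. -/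
def Builds (t : CWExpr V c) (G : SimpleGraph V) : Prop :=
  t.Valid ∧ t.verts = Set.univ ∧ ∀ x y, t.Adj x y ↔ G.Adj x y

end CWExpr

/-- The clique-width of a (finite) graph: the least number of labels in an expression
that builds it. -/
noncomputable def SimpleGraph.cliqueWidth {V : Type*} (G : SimpleGraph V) : ℕ :=
  sInf {c : ℕ | ∃ t : CWExpr V c, t.Builds G}

/-- Every finite nonempty graph is built by some expression, so that its clique-width is a genuine
minimum. -/
theorem SimpleGraph.exists_cwExpr {V : Type*} [Finite V] [Nonempty V] (G : SimpleGraph V) :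
    ∃ (c : ℕ) (t : CWExpr V c), t.Builds G := by
  classical
  obtain ⟨n, ⟨e⟩⟩ := Finite.exists_equiv_fin V
  have h1 : ∀ L : List V, L ≠ [] → L.Nodup → ∃ t : CWExpr V n, t.Valid ∧
      (∀ v m, t.HasLabel v m ↔ v ∈ L ∧ m = e v) ∧ ∀ x y, ¬ t.Adj x y := by
    intro L
    induction L with
    | nil => intro h; exact absurd rfl h
    | cons a L ih =>
      intro _ hn
      by_cases hL : L = []
      · subst hL
        exact ⟨.vertex a (e a), trivial, by simp +contextual [CWExpr.HasLabel],
          fun _ _ h => h⟩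
      · obtain ⟨t, hv, hl, ha⟩ := ih hL (List.nodup_cons.1 hn).2
        refine ⟨.union (.vertex a (e a)) t, ⟨trivial, hv, ?_⟩, ?_, ?_⟩
        · rw [Set.disjoint_left]
          rintro x ⟨m, hx, -⟩ ⟨m', hx'⟩
          subst hx
          exact (List.nodup_cons.1 hn).1 ((hl _ _).1 hx').1
        · intro v m
          simp only [CWExpr.HasLabel, hl, List.mem_cons]
          constructor
          · rintro (⟨rfl, rfl⟩ | ⟨h, rfl⟩) <;> simp [*]
          · rintro ⟨rfl | h, rfl⟩ <;> simp [*]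
        · intro x y h
          exact h.elim (fun h => h) (ha x y)
  have h2 : ∀ M : List (V × V), (∀ p ∈ M, G.Adj p.1 p.2) → ∃ t : CWExpr V n, t.Valid ∧
      (∀ v m, t.HasLabel v m ↔ m = e v) ∧ ∀ x y, t.Adj x y ↔ (x, y) ∈ M ∨ (y, x) ∈ M := by
    intro M
    induction M with
    | nil =>
      intro _
      have := Fintype.ofFinite V
      obtain ⟨t, hv, hl, ha⟩ := h1 Finset.univ.toList (by simp [Finset.univ_nonempty.ne_empty]) (Finset.nodup_toList _)
      exact ⟨t, hv, by simpa using hl, by simpa using ha⟩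
    | cons p M ih =>
      intro h
      obtain ⟨t, hv, hl, ha⟩ := ih (fun q hq => h q (List.mem_cons_of_mem _ hq))
      refine ⟨.join (e p.1) (e p.2) t,
        ⟨fun hp => (h p List.mem_cons_self).ne (e.injective hp), hv⟩, hl, ?_⟩
      intro x y
      simp only [CWExpr.Adj, hl, ha, List.mem_cons, Prod.ext_iff, e.injective.eq_iff]
      grind
  have := Fintype.ofFinite V
  obtain ⟨t, hv, hl, ha⟩ := h2 (Finset.univ.filter fun p : V × V => G.Adj p.1 p.2).toList
    (by simp)
  refine ⟨n, t, hv, Set.eq_univ_of_forall fun v => ⟨e v, (hl _ _).2 rfl⟩, fun x y => ?_⟩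
  rw [ha]
  simp [G.adj_comm y x]

/-! ### Layered wheels -/

namespace LayeredWheel

variable {V : Type*}

/-- The vertices of the layers `P (i-1), …, P 0`, listed layer by layer in this order
(the latest layer first) and from left to right inside each layer. -/
def earlier (P : ℕ → List V) : ℕ → List V
  | 0 => []
  | i + 1 => P i ++ earlier P i

open Classical in
/-- The ancestors of a vertex `x` of layer `i`: its neighbours in the layers before `i`,
listed in the order of `earlier`. The type of `x` is the length of this list. -/
noncomputable def ancestors (G : SimpleGraph V) (P : ℕ → List V) (i : ℕ) (x : V) : List V :=
  (earlier P i).filter (fun y => G.Adj x y)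

/-- The same ancestors, as a set. -/
def ancestorSet (G : SimpleGraph V) (P : ℕ → List V) (i : ℕ) (x : V) : Set V :=
  {y | y ∈ ancestors G P i x}

open Classical in
/-- The ancestor sets of the vertices of positive type met along layer `i`, from left to right. -/
noncomputable def word (G : SimpleGraph V) (P : ℕ → List V) (i : ℕ) : List (Set V) :=
  ((P i).map (ancestorSet G P i)).filter (fun S => S.Nonempty)

/-- Positions `a < b` of layer `i` carry consecutive vertices of positive type: all vertices
strictly between them have type 0. -/
def ConsecutiveTyped (G : SimpleGraph V) (P : ℕ → List V) (i a b : ℕ)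
    (ha : a < (P i).length) (hb : b < (P i).length) : Prop :=
  a < b ∧ ancestors G P i (P i)[a] ≠ [] ∧ ancestors G P i (P i)[b] ≠ [] ∧
    ∀ (m : ℕ) (hm : m < (P i).length), a < m → m < b → ancestors G P i (P i)[m] = []

/-- What both constructions share. The vertex set of `G` is partitioned into the `l + 1` layers
`P 0, …, P l`, each of which lists the vertices of an induced path from left to right;
the layer `P 0` is a single vertex, and the ends of the other layers have positive type. -/
structure IsLayering (G : SimpleGraph V) (l : ℕ) (P : ℕ → List V) : Prop where
  cover : ∀ x : V, ∃ i ≤ l, x ∈ P i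
  nodup : (earlier P (l + 1)).Nodup
  isPath : ∀ i ≤ l, ∀ (a b : ℕ) (ha : a < (P i).length) (hb : b < (P i).length),
    G.Adj (P i)[a] (P i)[b] ↔ a + 1 = b ∨ b + 1 = a
  first : (P 0).length = 1
  leftEnd : ∀ i, 1 ≤ i → i ≤ l → ∀ x ∈ (P i).head?, ancestors G P i x ≠ []
  rightEnd : ∀ i, 1 ≤ i → i ≤ l → ∀ x ∈ (P i).getLast?, ancestors G P i x ≠ []

/-- `Box_u` in a ttf-layered-wheel, for a vertex `u` with list of ancestors `A`: the ancestor sets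
of the vertices of positive type of `Box_u`, from left to right. In type 0 these are three
neighbours of `u`; in type 1, with ancestor `v`, three neighbours of `u`, three of `v`, and three
of `u`. (No vertex has type 2 or more.) -/
def ttfBox (u : V) (A : List V) : List (Set V) :=
  match A with
  | [] => List.replicate 3 {u}
  | v :: _ => List.replicate 3 {u} ++ List.replicate 3 {v} ++ List.replicate 3 {u}

/-- The layers `P` present `G` as an `(l, k)`-ttf-layered-wheel: `P (i+1)` goes through the boxes of
the vertices of `P i`, in the order of `P i`, and its subpaths between consecutive vertices of
positive type have length at least `k - 2`. -/
structure IsTtfPresentation (G : SimpleGraph V) (l k : ℕ) (P : ℕ → List V) : Prop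
    extends IsLayering G l P where
  boxes : ∀ i < l, word G P (i + 1) = (P i).flatMap (fun u => ttfBox u (ancestors G P i u))
  gaps : ∀ i, 1 ≤ i → i ≤ l → ∀ (a b : ℕ) (ha : a < (P i).length) (hb : b < (P i).length),
    ConsecutiveTyped G P i a b ha hb → k ≤ (b - a) + 2

/-- `G` is an `(l, k)`-ttf-layered-wheel. -/
def IsTtf (G : SimpleGraph V) (l k : ℕ) : Prop :=
  ∃ P : ℕ → List V, IsTtfPresentation G l k P

/-- A zone `E_S` (`S = {u}` or `S = {u, v}`): four vertices with ancestor set `S`. -/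
def zoneE (S : Set V) : List (Set V) := List.replicate 4 S

/-- A zone `O_S` (`S = {u}` or `S = {u, v}`): three vertices with ancestor set `S`. -/
def zoneO (S : Set V) : List (Set V) := List.replicate 3 S

/-- `Box_u` in an ehf-layered-wheel, for a vertex `u` with list of ancestors `A`, without the zones
`E_{u',u}` and `E_{u,u''}` that it shares with the boxes of the left and right neighbours `u'` and
`u''` of `u` in its layer. In type 2, the ancestors `v, w` come with `v` in the later layer, or on
the left of `w` if they are in the same layer. (No vertex has type 3 or more.) -/
def ehfInnerBox (u : V) (A : List V) : List (Set V) :=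
  match A with
  | [] => zoneO {u}
  | [v] => zoneO {u} ++ zoneO {u, v} ++ zoneO {u}
  | v :: w :: _ =>
      zoneE {u} ++ zoneE {v, w} ++ zoneO {u} ++ zoneO {u, v} ++ zoneO {u} ++ zoneO {u, w} ++
        zoneO {u} ++ zoneE {v, w} ++ zoneE {u}

/-- The sequence of all boxes of the vertices of a path `Q`, from left to right, where the boxes
of consecutive vertices `u, u'` overlap exactly in the zone `E_{u,u'}`. If `Q` is a single vertex
`r` of type 0, this is the pattern of three neighbours of `r`. -/
def ehfBoxes (A : V → List V) : List V → List (Set V)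
  | [] => []
  | [u] => ehfInnerBox u (A u)
  | u :: u' :: Q => ehfInnerBox u (A u) ++ zoneE {u, u'} ++ ehfBoxes A (u' :: Q)

/-- The layers `P` present `G` as an `(l, k)`-ehf-layered-wheel: `P (i+1)` goes through the boxes of
the vertices of `P i`, in the order of `P i`; its subpaths between consecutive vertices of
positive type have length at least `k - 2`, which is odd if the two vertices have a common ancestor
and even otherwise. -/
structure IsEhfPresentation (G : SimpleGraph V) (l k : ℕ) (P : ℕ → List V) : Prop
    extends IsLayering G l P where
  boxes : ∀ i < l, word G P (i + 1) = ehfBoxes (ancestors G P i) (P i)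
  gaps : ∀ i, 1 ≤ i → i ≤ l → ∀ (a b : ℕ) (ha : a < (P i).length) (hb : b < (P i).length),
    ConsecutiveTyped G P i a b ha hb →
      k ≤ (b - a) + 2 ∧
      ((ancestorSet G P i (P i)[a] ∩ ancestorSet G P i (P i)[b]).Nonempty → Odd (b - a)) ∧
      (¬ (ancestorSet G P i (P i)[a] ∩ ancestorSet G P i (P i)[b]).Nonempty → Even (b - a))

/-- `G` is an `(l, k)`-ehf-layered-wheel. -/
def IsEhf (G : SimpleGraph V) (l k : ℕ) : Prop :=
  ∃ P : ℕ → List V, IsEhfPresentation G l k P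

end LayeredWheel

/-- `G` is a layered wheel `G_{l,k}`, of either kind. -/
def IsLayeredWheel {V : Type*} (G : SimpleGraph V) (l k : ℕ) : Prop :=
  LayeredWheel.IsTtf G l k ∨ LayeredWheel.IsEhf G l k

/-! ### Cuts along expressions -/

namespace CWExpr

variable {V : Type*} {c : ℕ}

/-! Once a sub-expression is complete, its vertices with equal labels receive the same neighbours
outside its vertex set `X`. With `c` labels, `X` therefore has at most `c` kinds of vertices as seen
from outside. A heaviest-branch descent (`Valid.exists_balanced`) finds such an `X` holding between
one and two thirds of a set of representatives, one for each layer of the later half.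

If every layer represented in `X`, or every layer represented outside `X`, were cut by `X`, more
than `(l+1)/6` layers would be cut. Cut layers need distinct labels (`IsRich.card_cut_layers_le`),
because no two adjacent vertices of a layer both have ancestors. If `6c < l+1`, some layer thus lies
inside `X` and another outside. The earlier of the two has more than `c` vertices, and each has a
private neighbour in the later one (`IsRich.exists_private`), which forces more than `c` labels
(`IsRich.length_le_of_separated`). -/

theorem Adj.mem_verts {t : CWExpr V c} {x y : V} (h : t.Adj x y) : x ∈ t.verts ∧ y ∈ t.verts := by
  induction t with
  | vertex v i => exact h.elim
  | union s t hs ht =>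
    rcases h with h | h
    · exact ⟨(hs h).1.imp fun _ => Or.inl, (hs h).2.imp fun _ => Or.inl⟩
    · exact ⟨(ht h).1.imp fun _ => Or.inr, (ht h).2.imp fun _ => Or.inr⟩
  | join i j t ht =>
    rcases h with h | h | h
    · exact ht h
    · exact ⟨⟨_, h.1⟩, ⟨_, h.2⟩⟩
    · exact ⟨⟨_, h.1⟩, ⟨_, h.2⟩⟩
  | relabel i j t ht =>
    obtain ⟨⟨m, hm⟩, ⟨m', hm'⟩⟩ := ht h
    exact ⟨⟨_, m, hm, rfl⟩, ⟨_, m', hm', rfl⟩⟩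

theorem HasLabel.unique {t : CWExpr V c} (hv : t.Valid) {x : V} {m m' : Fin c}
    (h : t.HasLabel x m) (h' : t.HasLabel x m') : m = m' := by
  induction t generalizing m m' with
  | vertex v i => exact h.2.trans h'.2.symm
  | union s t hs ht =>
    have hd := Set.disjoint_left.1 hv.2.2
    rcases h with h | h <;> rcases h' with h' | h'
    · exact hs hv.1 h h'
    · exact (hd ⟨_, h⟩ ⟨_, h'⟩).elim
    · exact (hd ⟨_, h'⟩ ⟨_, h⟩).elim
    · exact ht hv.2.1 h h'
  | join i j t ht => exact ht hv.2 h h'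
  | relabel i j t ht =>
    obtain ⟨a, ha, rfl⟩ := h
    obtain ⟨b, hb, rfl⟩ := h'
    rw [ht hv ha hb]

/-- Vertices of `X` with the same value of `lab` have the same label in `t` and the same neighbours
outside `X` in the graph built by `t`. -/
def Splits (t : CWExpr V c) (X : Set V) (lab : V → Fin c) : Prop :=
  X ⊆ t.verts ∧ ∀ x ∈ X, ∀ y ∈ X, lab x = lab y →
    (∀ m, t.HasLabel x m ↔ t.HasLabel y m) ∧ ∀ z ∉ X, t.Adj x z ↔ t.Adj y z

theorem Valid.exists_splits_verts {t : CWExpr V c} (hv : t.Valid) (hne : t.verts.Nonempty) :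
    ∃ lab, t.Splits t.verts lab := by
  classical
  obtain ⟨v₀, m₀, -⟩ := hne
  -- `m₀` is a dummy label for vertices that `t` does not create.
  have h : ∀ v, ∃ m, v ∈ t.verts → t.HasLabel v m := fun v => by
    by_cases hv : v ∈ t.verts
    · exact hv.imp fun m hm _ => hm
    · exact ⟨m₀, fun h => (hv h).elim⟩
  choose lab hlab using h
  refine ⟨lab, subset_rfl, fun x hx y hy hxy => ⟨fun m => ?_, fun z hz => ?_⟩⟩
  · have h1 := hlab x hx
    have h2 := hlab y hy
    rw [← hxy] at h2
    exact ⟨fun h => h1.unique hv h ▸ h2, fun h => h2.unique hv h ▸ h1⟩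
  · exact ⟨fun h => (hz h.mem_verts.2).elim, fun h => (hz h.mem_verts.2).elim⟩

/-- The other side of a disjoint union contains no vertex of `X`, so it changes neither labels nor
adjacencies there. -/
theorem Splits.union_left {s t : CWExpr V c} (hd : Disjoint s.verts t.verts) {X : Set V}
    {lab : V → Fin c} (h : s.Splits X lab) : (union s t).Splits X lab := by
  have hd' := Set.disjoint_left.1 hd
  have hl : ∀ x ∈ X, ∀ m, ¬ t.HasLabel x m := fun x hx m hm => hd' (h.1 hx) ⟨m, hm⟩
  have ha : ∀ x ∈ X, ∀ z, ¬ t.Adj x z := fun x hx z hz => hd' (h.1 hx) hz.mem_verts.1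
  refine ⟨fun x hx => (h.1 hx).imp fun _ => Or.inl, fun x hx y hy hxy => ?_⟩
  obtain ⟨h1, h2⟩ := h.2 x hx y hy hxy
  refine ⟨fun m => ?_, fun z hz => ?_⟩
  · simp only [HasLabel, hl x hx, hl y hy, or_false, h1]
  · simp only [Adj, ha x hx, ha y hy, or_false, h2 z hz]

theorem Splits.union_right {s t : CWExpr V c} (hd : Disjoint s.verts t.verts) {X : Set V}
    {lab : V → Fin c} (h : t.Splits X lab) : (union s t).Splits X lab := by
  have hd' := Set.disjoint_right.1 hd
  have hl : ∀ x ∈ X, ∀ m, ¬ s.HasLabel x m := fun x hx m hm => hd' (h.1 hx) ⟨m, hm⟩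
  have ha : ∀ x ∈ X, ∀ z, ¬ s.Adj x z := fun x hx z hz => hd' (h.1 hx) hz.mem_verts.1
  refine ⟨fun x hx => (h.1 hx).imp fun _ => Or.inr, fun x hx y hy hxy => ?_⟩
  obtain ⟨h1, h2⟩ := h.2 x hx y hy hxy
  refine ⟨fun m => ?_, fun z hz => ?_⟩
  · simp only [HasLabel, hl x hx, hl y hy, false_or, h1]
  · simp only [Adj, ha x hx, ha y hy, false_or, h2 z hz]

/-- A join acts through current labels only, and these agree whenever `lab` does; this is why
`Splits` tracks both. -/
theorem Splits.join {t : CWExpr V c} {X : Set V} {lab : V → Fin c} (h : t.Splits X lab)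
    (i j : Fin c) : (join i j t).Splits X lab := by
  refine ⟨h.1, fun x hx y hy hxy => ?_⟩
  obtain ⟨h1, h2⟩ := h.2 x hx y hy hxy
  refine ⟨h1, fun z hz => ?_⟩
  simp only [Adj, h1, h2 z hz]

theorem verts_relabel (t : CWExpr V c) (i j : Fin c) : (relabel i j t).verts = t.verts := by
  ext x
  exact ⟨fun ⟨_, m, hm, _⟩ => ⟨m, hm⟩, fun ⟨m, hm⟩ => ⟨_, m, hm, rfl⟩⟩

theorem Splits.relabel {t : CWExpr V c} {X : Set V} {lab : V → Fin c} (h : t.Splits X lab)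
    (i j : Fin c) : (relabel i j t).Splits X lab := by
  refine ⟨(verts_relabel t i j).symm ▸ h.1, fun x hx y hy hxy => ?_⟩
  obtain ⟨h1, h2⟩ := h.2 x hx y hy hxy
  refine ⟨fun m => ?_, h2⟩
  simp only [HasLabel, h1]

open Classical in
/-- A balanced cut of a set `W` of vertices along a sub-expression. -/
theorem Valid.exists_balanced {t : CWExpr V c} (hv : t.Valid) (W : Finset V) {N : ℕ} (hN : 2 ≤ N)
    (hW : 2 * N < 3 * (W.filter (· ∈ t.verts)).card) :
    ∃ (X : Set V) (lab : V → Fin c), t.Splits X lab ∧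
      N < 3 * (W.filter (· ∈ X)).card ∧ 3 * (W.filter (· ∈ X)).card ≤ 2 * N := by
  induction t with
  | vertex v i =>
    have : (W.filter (· ∈ (vertex v i : CWExpr V c).verts)).card ≤ 1 := by
      refine Finset.card_le_one.2 fun a ha b hb => ?_
      obtain ⟨_, ha, -⟩ := (Finset.mem_filter.1 ha).2
      obtain ⟨_, hb, -⟩ := (Finset.mem_filter.1 hb).2
      exact ha.trans hb.symm
    -- A leaf has weight at most 1, while `hW` and `2 ≤ N` ask for at least 2.
    omega
  | union s t hs ht =>
    have hne : ∀ r : CWExpr V c, N < 3 * (W.filter (· ∈ r.verts)).card → r.verts.Nonempty := by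
      intro r hr
      obtain ⟨x, hx⟩ := Finset.card_pos.1 (by omega : 0 < (W.filter (· ∈ r.verts)).card)
      exact ⟨x, (Finset.mem_filter.1 hx).2⟩
    by_cases h1 : 2 * N < 3 * (W.filter (· ∈ s.verts)).card
    · obtain ⟨X, lab, hX, h⟩ := hs hv.1 h1
      exact ⟨X, lab, hX.union_left hv.2.2, h⟩
    by_cases h2 : 2 * N < 3 * (W.filter (· ∈ t.verts)).card
    · obtain ⟨X, lab, hX, h⟩ := ht hv.2.1 h2
      exact ⟨X, lab, hX.union_right hv.2.2, h⟩
    -- Neither side exceeds `2N/3` but their total does, so one of them exceeds `N/3` and is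
    -- balanced.
    have h3 : (W.filter (· ∈ (union s t).verts)).card ≤
        (W.filter (· ∈ s.verts)).card + (W.filter (· ∈ t.verts)).card := by
      refine (Finset.card_le_card fun x hx => ?_).trans (Finset.card_union_le _ _)
      obtain ⟨hx, m, hm | hm⟩ := Finset.mem_filter.1 hx
      · exact Finset.mem_union_left _ (Finset.mem_filter.2 ⟨hx, m, hm⟩)
      · exact Finset.mem_union_right _ (Finset.mem_filter.2 ⟨hx, m, hm⟩)
    by_cases h4 : N < 3 * (W.filter (· ∈ s.verts)).card
    · obtain ⟨lab, hlab⟩ := hv.1.exists_splits_verts (hne s h4)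
      exact ⟨_, lab, hlab.union_left hv.2.2, h4, by omega⟩
    · have h5 : N < 3 * (W.filter (· ∈ t.verts)).card := by omega
      obtain ⟨lab, hlab⟩ := hv.2.1.exists_splits_verts (hne t h5)
      exact ⟨_, lab, hlab.union_right hv.2.2, h5, by omega⟩
  | join i j t ht =>
    obtain ⟨X, lab, hX, h⟩ := ht hv.2 hW
    exact ⟨X, lab, hX.join i j, h⟩
  | relabel i j t ht =>
    obtain ⟨X, lab, hX, h⟩ := ht hv (verts_relabel t i j ▸ hW)
    exact ⟨X, lab, hX.relabel i j, h⟩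

end CWExpr

/-! ### Layers and ancestors -/

namespace LayeredWheel

variable {V : Type*} {G : SimpleGraph V} {P : ℕ → List V} {l k : ℕ}

theorem mem_earlier {i : ℕ} {x : V} : x ∈ earlier P i ↔ ∃ j < i, x ∈ P j := by
  induction i with
  | zero => simp [earlier]
  | succ i ih =>
    simp only [earlier, List.mem_append, ih, Nat.lt_succ_iff_lt_or_eq]
    grind

theorem mem_ancestors {i : ℕ} {x y : V} :
    y ∈ ancestors G P i x ↔ (∃ j < i, y ∈ P j) ∧ G.Adj x y := by
  simp [ancestors, mem_earlier]

theorem earlier_sublist {i j : ℕ} (h : i ≤ j) : (earlier P i).Sublist (earlier P j) := by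
  induction h with
  | refl => exact List.Sublist.refl _
  | step _ ih => exact ih.trans (List.sublist_append_right _ _)

theorem mem_word {i : ℕ} {S : Set V} :
    S ∈ word G P i ↔ S.Nonempty ∧ ∃ v ∈ P i, ancestorSet G P i v = S := by
  simp [word, and_comm]

theorem length_word_le (i : ℕ) : (word G P i).length ≤ (P i).length :=
  (List.length_filter_le _ _).trans (List.length_map _).le

theorem IsLayering.nodup_earlier (h : IsLayering G l P) {i : ℕ} (hi : i ≤ l + 1) :
    (earlier P i).Nodup :=
  h.nodup.sublist (earlier_sublist hi)

theorem IsLayering.nodup_layer (h : IsLayering G l P) {i : ℕ} (hi : i ≤ l) : (P i).Nodup :=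
  (List.nodup_append.1 (h.nodup_earlier (i := i + 1) (by omega))).1

theorem IsLayering.nodup_ancestors (h : IsLayering G l P) {i : ℕ} (hi : i ≤ l) (x : V) :
    (ancestors G P i x).Nodup :=
  (h.nodup_earlier (by omega)).filter _

theorem IsLayering.notMem_of_lt (h : IsLayering G l P) {i j : ℕ} (hij : i < j) (hj : j ≤ l) {x : V}
    (hx : x ∈ P j) : x ∉ P i := fun hx' =>
  (List.nodup_append.1 (h.nodup_earlier (i := j + 1) (by omega))).2.2 x hx x
    (mem_earlier.2 ⟨i, hij, hx'⟩) rfl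

theorem IsLayering.eq_of_mem (h : IsLayering G l P) {i j : ℕ} (hi : i ≤ l) (hj : j ≤ l) {x : V}
    (hx : x ∈ P i) (hx' : x ∈ P j) : i = j := by
  rcases lt_trichotomy i j with hij | hij | hij
  · exact (h.notMem_of_lt hij hj hx' hx).elim
  · exact hij
  · exact (h.notMem_of_lt hij hi hx hx').elim

/-- The properties of both kinds of layered wheels that bound their clique-width. -/
structure IsRich (G : SimpleGraph V) (l : ℕ) (P : ℕ → List V) : Prop
    extends IsLayering G l P where
  sparse : ∀ i, 1 ≤ i → i ≤ l → ∀ (a : ℕ) (ha : a + 1 < (P i).length),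
    ancestors G P i (P i)[a] = [] ∨ ancestors G P i (P i)[a + 1] = []
  child : ∀ i < l, ∀ u ∈ P i, {u} ∈ word G P (i + 1)
  -- An ancestor `v` is passed on alone in a ttf-wheel, and together with `u` in an ehf-wheel.
  -- Taking `v = w` covers type 1.
  inherit : ∀ i < l, ∀ u ∈ P i, ∀ v w, ancestorSet G P i u = {v, w} →
    {v} ∈ word G P (i + 1) ∨ {v, u} ∈ word G P (i + 1)
  grow : ∀ i < l, 3 * (P i).length ≤ (word G P (i + 1)).length

/-! ### Both kinds of wheels are rich -/

theorem IsTtfPresentation.ancestorSet_eq_singleton (h : IsTtfPresentation G l k P) {i : ℕ}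
    (hi : i ≤ l) {u : V} (hu : u ∈ P i) (hne : (ancestorSet G P i u).Nonempty) :
    ∃ a, ancestorSet G P i u = {a} := by
  cases i with
  | zero =>
    obtain ⟨y, hy⟩ := hne
    obtain ⟨⟨j, hj, -⟩, -⟩ := mem_ancestors.1 hy
    omega
  | succ i =>
    have hw : ancestorSet G P (i + 1) u ∈ word G P (i + 1) := mem_word.2 ⟨hne, u, hu, rfl⟩
    rw [h.boxes i hi, List.mem_flatMap] at hw
    obtain ⟨x, -, hx⟩ := hw
    unfold ttfBox at hx
    split at hx
    · exact ⟨_, List.eq_of_mem_replicate hx⟩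
    · simp only [List.mem_append] at hx
      rcases hx with (hx | hx) | hx <;> exact ⟨_, List.eq_of_mem_replicate hx⟩

theorem IsTtfPresentation.isRich (h : IsTtfPresentation G l k P) (hk : 4 ≤ k) : IsRich G l P where
  toIsLayering := h.toIsLayering
  sparse i h1 hi a ha := by
    by_contra! hc
    -- Adjacent vertices are at distance 1, below `k - 2 ≥ 2`.
    have := h.gaps i h1 hi a (a + 1) (by omega) ha
      ⟨by omega, hc.1, hc.2, fun m _ _ _ => by omega⟩
    omega
  child i hi u hu := by
    rw [h.boxes i hi, List.mem_flatMap]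
    refine ⟨u, hu, ?_⟩
    unfold ttfBox
    split <;> simp
  inherit i hi u hu v w hA := by
    left
    have hv : v ∈ ancestorSet G P i u := hA ▸ Set.mem_insert _ _
    obtain ⟨a, ha⟩ := h.ancestorSet_eq_singleton hi.le hu ⟨v, hv⟩
    obtain rfl : v = a := by simpa [ha] using hv
    rw [h.boxes i hi, List.mem_flatMap]
    refine ⟨u, hu, ?_⟩
    have hA' : ∀ y, y ∈ ancestors G P i u ↔ y = v := fun y => Set.ext_iff.1 ha y
    generalize ancestors G P i u = A at hA'
    match A with
    | [] => simpa using hA' v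
    | b :: A =>
      obtain rfl : b = v := (hA' b).1 List.mem_cons_self
      simp [ttfBox]
  grow i hi := by
    rw [h.boxes i hi, List.length_flatMap, mul_comm, ← smul_eq_mul, ← List.length_map (f := fun u =>
      (ttfBox u (ancestors G P i u)).length)]
    refine List.card_nsmul_le_sum _ _ fun n hn => ?_
    obtain ⟨u, -, rfl⟩ := List.mem_map.1 hn
    unfold ttfBox
    split <;> simp

theorem length_ehfInnerBox (u : V) (A : List V) : 3 ≤ (ehfInnerBox u A).length := by
  unfold ehfInnerBox
  split <;> simp [zoneO, zoneE]

theorem length_ehfBoxes (A : V → List V) (Q : List V) :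
    3 * Q.length ≤ (ehfBoxes A Q).length := by
  induction Q with
  | nil => simp
  | cons u Q ih =>
    have := length_ehfInnerBox u (A u)
    cases Q with
    | nil => simpa [ehfBoxes]
    | cons u' Q =>
      simp only [ehfBoxes, List.length_append, List.length_cons] at ih ⊢
      omega

theorem mem_ehfBoxes {A : V → List V} {Q : List V} {u : V} (hu : u ∈ Q) {S : Set V}
    (hS : S ∈ ehfInnerBox u (A u)) : S ∈ ehfBoxes A Q := by
  induction Q with
  | nil => simp at hu
  | cons a Q ih =>
    cases Q with
    | nil =>
      obtain rfl := List.mem_singleton.1 hu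
      exact hS
    | cons b Q =>
      simp only [ehfBoxes, List.mem_append]
      rcases List.mem_cons.1 hu with rfl | hu
      · exact Or.inl (Or.inl hS)
      · exact Or.inr (ih hu)

theorem IsEhfPresentation.isRich (h : IsEhfPresentation G l k P) (hk : 4 ≤ k) : IsRich G l P where
  toIsLayering := h.toIsLayering
  sparse i h1 hi a ha := by
    by_contra! hc
    have := (h.gaps i h1 hi a (a + 1) (by omega) ha
      ⟨by omega, hc.1, hc.2, fun m _ _ _ => by omega⟩).1
    omega
  child i hi u hu := by
    rw [h.boxes i hi]
    refine mem_ehfBoxes hu ?_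
    unfold ehfInnerBox
    split <;> simp [zoneO, zoneE]
  inherit i hi u hu v w hA := by
    right
    rw [h.boxes i hi]
    refine mem_ehfBoxes hu ?_
    have hA' : ∀ y, y ∈ ancestors G P i u ↔ y = v ∨ y = w := fun y => Set.ext_iff.1 hA y
    have hn := h.nodup_ancestors hi.le u
    generalize ancestors G P i u = A at hA' hn
    rw [Set.pair_comm]
    match A with
    | [] => simpa using hA' v
    | [a] =>
      obtain rfl : v = a := by simpa using hA' v
      simp [ehfInnerBox, zoneO]
    | a :: b :: A =>
      -- By `hn`, `a` and `b` are distinct elements of `{v, w}`, so they exhaust it.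
      have : v = a ∨ v = b := by
        have ha := hA' a
        have hb := hA' b
        grind
      rcases this with rfl | rfl <;> simp [ehfInnerBox, zoneO, zoneE]
  grow i hi := by
    rw [h.boxes i hi]
    exact length_ehfBoxes _ _

/-! ### Growth and private neighbours -/

theorem IsRich.lt_length (h : IsRich G l P) {i : ℕ} (hi : i ≤ l) : i < (P i).length := by
  induction i with
  | zero => simp [h.first]
  | succ i ih =>
    have := ih (by omega)
    have := h.grow i (by omega)
    have := length_word_le (G := G) (P := P) (i + 1)
    omega

/-- Every vertex of a layer has a private neighbour in each later layer. -/
theorem IsRich.exists_private (h : IsRich G l P) {i j : ℕ} (hij : i < j) (hj : j ≤ l) {u : V}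
    (hu : u ∈ P i) : ∃ v ∈ P j, G.Adj v u ∧ ∀ u' ∈ P i, G.Adj v u' → u' = u := by
  -- The induction carries the whole ancestor set: `u` and at most one other vertex, which must
  -- avoid layer `i`.
  suffices H : ∃ v ∈ P j, ∃ w, ancestorSet G P j v = {u, w} ∧ (w ∈ P i → w = u) by
    obtain ⟨v, hv, w, hA, hw⟩ := H
    have hA' : ∀ y, y ∈ ancestors G P j v ↔ y = u ∨ y = w := fun y => Set.ext_iff.1 hA y
    refine ⟨v, hv, (mem_ancestors.1 ((hA' u).2 (Or.inl rfl))).2, fun u' hu' ha => ?_⟩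
    rcases (hA' u').1 (mem_ancestors.2 ⟨⟨i, hij, hu'⟩, ha⟩) with rfl | rfl
    · rfl
    · exact hw hu'
  induction j, hij using Nat.le_induction with
  | base =>
    obtain ⟨-, v, hv, hA⟩ := mem_word.1 (h.child i hj u hu)
    exact ⟨v, hv, u, by simpa using hA, fun _ => rfl⟩
  | succ j hij ih =>
    obtain ⟨x, hx, w, hA, hw⟩ := ih (by omega)
    rcases h.inherit j hj x hx u w hA with H | H
    · obtain ⟨-, v, hv, hA⟩ := mem_word.1 H
      exact ⟨v, hv, u, by simpa using hA, fun _ => rfl⟩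
    -- Here the second ancestor is `x`, from layer `j > i`, hence outside `P i`.
    · obtain ⟨-, v, hv, hA⟩ := mem_word.1 H
      exact ⟨v, hv, x, hA, fun hx' => (h.notMem_of_lt hij (by omega) hx hx').elim⟩

theorem IsRich.not_both_typed (h : IsRich G l P) {i : ℕ} (h1 : 1 ≤ i) (hi : i ≤ l) {x y : V}
    (hx : x ∈ P i) (hy : y ∈ P i) (hxy : G.Adj x y) :
    ancestors G P i x = [] ∨ ancestors G P i y = [] := by
  obtain ⟨a, ha, rfl⟩ := List.getElem_of_mem hx
  obtain ⟨b, hb, rfl⟩ := List.getElem_of_mem hy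
  rcases (h.isPath i hi a b ha hb).1 hxy with rfl | rfl
  · exact h.sparse i h1 hi a hb
  · exact (h.sparse i h1 hi b ha).symm

/-! ### Labels forced by cut and separated layers -/

theorem exists_getElem_succ_of_mem {Q : List V} {X : Set V} (h1 : ∃ x ∈ Q, x ∈ X)
    (h2 : ∃ x ∈ Q, x ∉ X) :
    ∃ (a : ℕ) (ha : a + 1 < Q.length), (Q[a] ∈ X ∧ Q[a + 1] ∉ X) ∨ (Q[a] ∉ X ∧ Q[a + 1] ∈ X) := by
  by_contra! H
  have key : ∀ (a : ℕ) (ha : a < Q.length), Q[a] ∈ X ↔ Q[0] ∈ X := by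
    intro a
    induction a with
    | zero => simp
    | succ a ih =>
      intro ha
      have := H a ha
      rw [← ih (by omega)]
      tauto
  obtain ⟨x, hx, hxX⟩ := h1
  obtain ⟨y, hy, hyX⟩ := h2
  obtain ⟨a, ha, rfl⟩ := List.getElem_of_mem hx
  obtain ⟨b, hb, rfl⟩ := List.getElem_of_mem hy
  exact hyX ((key b hb).2 ((key a ha).1 hxX))

/-- A layer that meets `X` and its complement has an edge across. -/
theorem IsLayering.exists_cut_edge (h : IsLayering G l P) {i : ℕ} (hi : i ≤ l) {X : Set V}
    (h1 : ∃ x ∈ P i, x ∈ X) (h2 : ∃ x ∈ P i, x ∉ X) :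
    ∃ x ∈ P i, ∃ y ∈ P i, x ∈ X ∧ y ∉ X ∧ G.Adj x y := by
  obtain ⟨a, ha, H⟩ := exists_getElem_succ_of_mem h1 h2
  have hadj := (h.isPath i hi a (a + 1) (by omega) ha).2 (Or.inl rfl)
  rcases H with H | H
  · exact ⟨_, List.getElem_mem _, _, List.getElem_mem _, H.1, H.2, hadj⟩
  · exact ⟨_, List.getElem_mem _, _, List.getElem_mem _, H.2, H.1, hadj.symm⟩

section Cut

variable {c : ℕ} {X : Set V} {lab : V → Fin c}

/-- Layers cut by `X` need distinct labels. -/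
theorem IsRich.card_cut_layers_le (h : IsRich G l P)
    (hX : ∀ x ∈ X, ∀ y ∈ X, lab x = lab y → ∀ z ∉ X, G.Adj x z ↔ G.Adj y z) (B : Finset ℕ)
    (hB : ∀ i ∈ B, i ≤ l ∧ (∃ x ∈ P i, x ∈ X) ∧ ∃ x ∈ P i, x ∉ X) : B.card ≤ c := by
  have H : ∀ i : B, ∃ p : V × V, p.1 ∈ P i ∧ p.2 ∈ P i ∧ p.1 ∈ X ∧ p.2 ∉ X ∧ G.Adj p.1 p.2 := by
    rintro ⟨i, hi⟩
    obtain ⟨h0, h1, h2⟩ := hB i hi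
    obtain ⟨x, hx, y, hy, h⟩ := h.exists_cut_edge h0 h1 h2
    exact ⟨(x, y), hx, hy, h⟩
  choose p hp1 hp2 hp1X hp2X hadj using H
  -- Equal labels would make the cut edges exchange neighbours: both ends of the edge in layer `j`
  -- would have an ancestor in layer `i`.
  have key : ∀ i j : B, i.1 < j.1 → lab (p i).1 ≠ lab (p j).1 := by
    intro i j hij hlab
    have e := hX _ (hp1X i) _ (hp1X j) hlab
    have e1 := (e _ (hp2X i)).1 (hadj i)
    have e2 := (e _ (hp2X j)).2 (hadj j)
    rcases h.not_both_typed (by omega) (hB j j.2).1 (hp1 j) (hp2 j) (hadj j) with h0 | h0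
    · exact List.ne_nil_of_mem (mem_ancestors.2 ⟨⟨i, hij, hp2 i⟩, e1⟩) h0
    · exact List.ne_nil_of_mem (mem_ancestors.2 ⟨⟨i, hij, hp1 i⟩, e2.symm⟩) h0
  have hinj : Function.Injective fun i : B => lab (p i).1 := by
    intro i j hij
    by_contra hne
    rcases lt_or_gt_of_ne (fun e => hne (Subtype.ext e) : i.1 ≠ j.1) with h' | h'
    · exact key i j h' hij
    · exact key j i h' hij.symm
  simpa using Fintype.card_le_of_injective _ hinj

/-- Two layers on different sides of `X` need as many labels as the first one has vertices. -/
theorem IsRich.length_le_of_separated (h : IsRich G l P)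
    (hX : ∀ x ∈ X, ∀ y ∈ X, lab x = lab y → ∀ z ∉ X, G.Adj x z ↔ G.Adj y z) {i j : ℕ}
    (hij : i < j) (hj : j ≤ l)
    (hs : ((∀ x ∈ P i, x ∈ X) ∧ ∀ x ∈ P j, x ∉ X) ∨ ((∀ x ∈ P i, x ∉ X) ∧ ∀ x ∈ P j, x ∈ X)) :
    (P i).length ≤ c := by
  have H : ∀ u : {u // u ∈ P i}, ∃ v ∈ P j, G.Adj v u ∧ ∀ u' ∈ P i, G.Adj v u' → u' = u :=
    fun u => h.exists_private hij hj u.2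
  choose f hf hadj hpriv using H
  have : ∃ g : {u // u ∈ P i} → Fin c, Function.Injective g := by
    -- The labels on the `X` side are counted: those of the vertices of `P i`, or those of their
    -- private neighbours.
    rcases hs with ⟨h1, h2⟩ | ⟨h1, h2⟩
    · refine ⟨fun u => lab u, fun u u' e => Subtype.ext ?_⟩
      exact hpriv u' u u.2
        ((hX u (h1 u u.2) u' (h1 u' u'.2) e _ (h2 _ (hf u'))).2 (hadj u').symm).symm
    · refine ⟨fun u => lab (f u), fun u u' e => Subtype.ext ?_⟩
      exact hpriv u' u u.2
        ((hX _ (h2 _ (hf u)) _ (h2 _ (hf u')) e u (h1 u u.2)).1 (hadj u))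
  obtain ⟨g, hg⟩ := this
  let e : Fin (P i).length → {u // u ∈ P i} := fun a => ⟨(P i)[a], List.getElem_mem _⟩
  have he : Function.Injective e := fun a b hab => Fin.ext <|
    (h.nodup_layer (hij.le.trans hj)).getElem_inj_iff.1 (congrArg Subtype.val hab)
  simpa using Fintype.card_le_of_injective _ (hg.comp he)

end Cut

/-! ### The lower bound -/

theorem IsRich.le_of_builds (h : IsRich G l P) (hl : 2 ≤ l) {c : ℕ} {t : CWExpr V c}
    (ht : t.Builds G) : l + 1 ≤ 6 * c := by
  classical
  by_contra! hlt
  have hpos : ∀ i, ∃ v, i ≤ l → v ∈ P i := by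
    intro i
    by_cases hi : i ≤ l
    · exact (List.exists_mem_of_length_pos (Nat.zero_lt_of_lt (h.lt_length hi))).imp fun v hv _ => hv
    · obtain ⟨v, -⟩ := List.exists_mem_of_length_pos (Nat.zero_lt_of_lt (h.lt_length l.zero_le))
      exact ⟨v, fun h => (hi h).elim⟩
  choose r hr using hpos
  -- Starting halfway keeps at least `(l+1)/2` layers, a third of which is already `(l+1)/6`, and
  -- gives each of them more than `m` vertices.
  obtain ⟨m, hm⟩ : ∃ m, m = (l + 1) / 2 := ⟨_, rfl⟩
  have hI : ∀ i, i ∈ Finset.Icc m l ↔ m ≤ i ∧ i ≤ l := fun i => Finset.mem_Icc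
  generalize hIdef : Finset.Icc m l = I at hI
  have hIcard : I.card = l + 1 - m := by rw [← hIdef, Nat.card_Icc]
  have hinj : Set.InjOn r I := fun i hi j hj e =>
    h.eq_of_mem ((hI i).1 hi).2 ((hI j).1 hj).2 (hr i ((hI i).1 hi).2) (e ▸ hr j ((hI j).1 hj).2)
  have hcard : ∀ X : Set V,
      ((I.image r).filter (· ∈ X)).card = (I.filter fun i => r i ∈ X).card := by
    intro X
    rw [Finset.filter_image, Finset.card_image_of_injOn (hinj.mono (Finset.coe_subset.2 (Finset.filter_subset _ _)))]
  obtain ⟨X, lab, hX, hlo, hhi⟩ := ht.1.exists_balanced (I.image r) (N := I.card) (by omega) (by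
    rw [hcard, ht.2.1]
    simp
    omega)
  rw [hcard] at hlo hhi
  have hX' : ∀ x ∈ X, ∀ y ∈ X, lab x = lab y → ∀ z ∉ X, G.Adj x z ↔ G.Adj y z := by
    intro x hx y hy e z hz
    rw [← ht.2.2, ← ht.2.2]
    exact (hX.2 x hx y hy e).2 z hz
  have hsum := Finset.card_filter_add_card_filter_not (s := I) (fun i => r i ∈ X)
  -- Otherwise all layers represented in `X` are cut; they number more than `I.card / 3`, hence more
  -- than `c`.
  obtain ⟨i, hi, hiX⟩ : ∃ i ∈ I, ∀ x ∈ P i, x ∈ X := by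
    by_contra! H
    have := h.card_cut_layers_le hX' (I.filter fun i => r i ∈ X) fun i hi => by
      obtain ⟨hi, hiX⟩ := Finset.mem_filter.1 hi
      exact ⟨((hI i).1 hi).2, ⟨r i, hr i ((hI i).1 hi).2, hiX⟩, H i hi⟩
    omega
  obtain ⟨j, hj, hjX⟩ : ∃ j ∈ I, ∀ x ∈ P j, x ∉ X := by
    by_contra! H
    have := h.card_cut_layers_le hX' (I.filter fun i => ¬ r i ∈ X) fun i hi => by
      obtain ⟨hi, hiX⟩ := Finset.mem_filter.1 hi
      exact ⟨((hI i).1 hi).2, H i hi, ⟨r i, hr i ((hI i).1 hi).2, hiX⟩⟩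
    omega
  rw [hI] at hi hj
  have h1 := h.lt_length hi.2
  have h2 := h.lt_length hj.2
  rcases lt_trichotomy i j with hij | rfl | hij
  · have := h.length_le_of_separated hX' hij hj.2 (Or.inl ⟨hiX, hjX⟩)
    omega
  · exact hjX _ (hr i hi.2) (hiX _ (hr i hi.2))
  · have := h.length_le_of_separated hX' hij hi.2 (Or.inr ⟨hjX, hiX⟩)
    omega

end LayeredWheel

theorem IsLayeredWheel.exists_isRich {V : Type*} {G : SimpleGraph V} {l k : ℕ} (hk : 4 ≤ k)
    (hG : IsLayeredWheel G l k) : ∃ P, LayeredWheel.IsRich G l P := by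
  rcases hG with ⟨P, hP⟩ | ⟨P, hP⟩
  · exact ⟨P, hP.isRich hk⟩
  · exact ⟨P, hP.isRich hk⟩

theorem mainTheorem7 {V : Type*} (G : SimpleGraph V) (l k : ℕ) (hl : 2 ≤ l) (hk : 4 ≤ k)
    (hG : IsLayeredWheel G l k) : ((l : ℝ) + 1) / 6 ≤ (G.cliqueWidth : ℝ) := by
  classical
  obtain ⟨P, hP⟩ := hG.exists_isRich hk
  have hne : Nonempty V :=
    (List.exists_mem_of_length_pos (Nat.zero_lt_of_lt (hP.lt_length l.zero_le))).nonempty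
  have hfin : Finite V := Set.finite_univ_iff.1 <|
    (LayeredWheel.earlier P (l + 1)).toFinset.finite_toSet.subset fun x _ => by
      obtain ⟨i, hi, hx⟩ := hP.cover x
      simpa [LayeredWheel.mem_earlier] using ⟨i, hi, hx⟩
  -- The infimum is attained because `V` is finite and nonempty; an empty set of label counts would
  -- have infimum 0.
  obtain ⟨t, ht⟩ : ∃ t : CWExpr V G.cliqueWidth, t.Builds G := Nat.sInf_mem G.exists_cwExpr
  have : (l : ℝ) + 1 ≤ 6 * (G.cliqueWidth : ℝ) := by exact_mod_cast hP.le_of_builds hl ht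
  linarith
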